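/- Let $N, L$ be positive integers and $[L]=\{0,1,\dots,L-1\}$. For $\kappa\in[L]$ put $\eta(\kappa)=e^{\pi i(2\kappa+1)/L}$ if $N$ is even and $\eta(\kappa)=e^{2\pi i\kappa/L}$ if $N$ is odd; these are the solutions of $\eta^L=(-1)^{N-1}$. For $\Delta\in\mathbb{R}$, the Bethe equations for $\boldsymbol\xi=(\xi_1,\dots,\xi_N)\in\mathbb{C}^N$ are $$\xi_i^L=(-1)^{N-1}\prod_{j\ne i}\frac{1+\xi_i\xi_j-2\Delta\xi_i}{1+\xi_i\xi_j-2\Delta\xi_j},\qquad i=1,\dots,N,$$ where a solution is required to have $1+\xi_i\xi_j-2\Delta\xi_j\neq0$ for all $i\neq j$ (a factor with $j=i$ would be identically $1$). Put $$F_i(\boldsymbol\xi)=\xi_i^L+(-1)^N\prod_{j\ne i}\frac{1+\xi_i\xi_j-2\Delta\xi_i}{1+\xi_i\xi_j-2\Delta\xi_j},\qquad J_i=\Big(\frac{\partial F_i}{\partial\xi_1},\dots,\frac{\partial F_i}{\partial\xi_N}\Big),$$ let $\Vert\cdot\Vert$ be the Hermitian norm on $\mathbb{C}^N$, and let $\overline{J_i}$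 be the entrywise complex conjugate of $J_i$. Given $k=(k_1,\dots,k_N)\in[L]^N$, the Newton–Kaczmarz sequence $\boldsymbol\xi(n)\in\mathbb{C}^N$, $n=0,1,2,\dots$, is defined by $\boldsymbol\xi(0)=(\eta(k_1),\dots,\eta(k_N))$ and $$\boldsymbol\xi(n,0)=\boldsymbol\xi(n),\qquad \boldsymbol\xi(n,i+1)=\boldsymbol\xi(n,i)-\frac{F_{i+1}(\boldsymbol\xi(n,i))}{\Vert J_{i+1}(\boldsymbol\xi(n,i))\Vert^2}\,\overline{J_{i+1}(\boldsymbol\xi(n,i))}\quad(0\le i\le N-1),\qquad \boldsymbol\xi(n+1)=\boldsymbol\xi(n,N).$$ Let $k\in[L]^N$ have pairwise distinct entries, and suppose that $1+\eta(k_i)\eta(k_j)\neq0$ for all $i\neq j$. Then there is an $\epsilon>0$ such that for every $\Delta\in\mathbb{R}$ with $|\Delta|<\epsilon$ the following holds. The sequence is well defined: for all $n\ge0$ and $0\le i\le N-1$, at the point $\boldsymbol\xi=\boldsymbol\xi(n,i)$ one has $1+\xi_a\xi_b-2\Delta\xi_b\ne0$ for all $a\ne b$, and $J_{i+1}(\boldsymbol\xi(n,i))\neq0$.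 Moreover, $\boldsymbol\xi(n)$ converges as $n\to\infty$, and its limit has pairwise distinct entries and solves the Bethe equations. -/

import Mathlib

open Filter Topology

noncomputable section

namespace XXZ

/-- The solutions of `η ^ L = (-1) ^ (N - 1)`, indexed by `k ∈ {0, …, L - 1}`. -/
def rootEta (N L : ℕ) (k : Fin L) : ℂ :=
  if Even N then
    Complex.exp (Real.pi * Complex.I * (2 * ((k : ℕ) : ℂ) + 1) / (L : ℂ))
  else
    Complex.exp (2 * Real.pi * Complex.I * ((k : ℕ) : ℂ) / (L : ℂ))

variable {N : ℕ}

/-- The base point `η(k) = (η(k₁), …, η(k_N))` for `k ∈ {0, …, L - 1} ^ N`. -/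
def basePoint (L : ℕ) (k : Fin N → Fin L) : Fin N → ℂ :=
  fun i => rootEta N L (k i)

/-- The quantity `1 + ξᵢ ξⱼ - 2 Δ ξⱼ`, the `j`-th denominator in the `i`-th Bethe equation; the
corresponding numerator `1 + ξᵢ ξⱼ - 2 Δ ξᵢ` is the one with `i` and `j` exchanged. -/
def betheDen (Δ : ℝ) (ξ : Fin N → ℂ) (i j : Fin N) : ℂ :=
  1 + ξ i * ξ j - 2 * (Δ : ℂ) * ξ j

/-- The product over `j` of `(1 + ξᵢ ξⱼ - 2 Δ ξᵢ) / (1 + ξᵢ ξⱼ - 2 Δ ξⱼ)`. The factor with `j = i`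
has equal numerator and denominator; it is the constant rational function `1` and is left out. -/
def betheProd (Δ : ℝ) (i : Fin N) (ξ : Fin N → ℂ) : ℂ :=
  ∏ j ∈ Finset.univ.erase i,
    (1 + ξ i * ξ j - 2 * (Δ : ℂ) * ξ i) / (1 + ξ i * ξ j - 2 * (Δ : ℂ) * ξ j)

/-- Keeping the factor `j = i` makes no difference where its denominator does not vanish. -/
theorem betheProd_eq_prod_univ (Δ : ℝ) (i : Fin N) (ξ : Fin N → ℂ)
    (h : betheDen Δ ξ i i ≠ 0) :
    betheProd Δ i ξ =
      ∏ j, (1 + ξ i * ξ j - 2 * (Δ : ℂ) * ξ i) / (1 + ξ i * ξ j - 2 * (Δ : ℂ) * ξ j) := by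
  unfold betheDen at h
  rw [← Finset.mul_prod_erase Finset.univ _ (Finset.mem_univ i), div_self h, one_mul, betheProd]

/-- All Bethe equations are defined at `ξ`: no denominator (and, by the symmetry between `i` and
`j`, no numerator) vanishes. -/
def BetheDefined (Δ : ℝ) (ξ : Fin N → ℂ) : Prop :=
  ∀ i j, i ≠ j → betheDen Δ ξ i j ≠ 0

/-- `ξ` solves the Bethe equations
`ξᵢ ^ L = (-1) ^ (N - 1) ∏ⱼ (1 + ξᵢ ξⱼ - 2 Δ ξᵢ) / (1 + ξᵢ ξⱼ - 2 Δ ξⱼ)`, none of whose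
denominators vanishes. -/
def IsBetheSolution (L : ℕ) (Δ : ℝ) (ξ : Fin N → ℂ) : Prop :=
  BetheDefined Δ ξ ∧ ∀ i, ξ i ^ L = (-1) ^ (N - 1) * betheProd Δ i ξ

/-- The function `Fᵢ` whose vanishing is the `i`-th Bethe equation. -/
def betheF (L : ℕ) (Δ : ℝ) (i : Fin N) (ξ : Fin N → ℂ) : ℂ :=
  ξ i ^ L + (-1) ^ N * betheProd Δ i ξ

/-- `Jᵢ = (∂Fᵢ/∂ξ₁, …, ∂Fᵢ/∂ξ_N)`, the vector of complex partial derivatives. -/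
def betheJ (L : ℕ) (Δ : ℝ) (i : Fin N) (ξ : Fin N → ℂ) : Fin N → ℂ :=
  fun j => fderiv ℂ (betheF L Δ i) ξ (Pi.single j 1)

/-- One Newton-Kaczmarz step for the `i`-th equation,
`ξ - (Fᵢ(ξ) / ‖Jᵢ(ξ)‖²) conj Jᵢ(ξ)`, with the Hermitian norm of `ℂ ^ N`: the orthogonal projection
of `ξ` onto the hyperplane `Fᵢ(ξ) + ∑ⱼ ∂Fᵢ/∂ξⱼ(ξ) (zⱼ - ξⱼ) = 0`. -/
def kaczmarzStep (L : ℕ) (Δ : ℝ) (i : Fin N) (ξ : Fin N → ℂ) : Fin N → ℂ :=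
  fun j => ξ j -
    betheF L Δ i ξ / ((∑ m, ‖betheJ L Δ i ξ m‖ ^ 2 : ℝ) : ℂ) *
      (starRingEnd ℂ) (betheJ L Δ i ξ j)

/-- The intermediate points of one sweep through the equations: `sweep L Δ ξ 0 = ξ`, and
`sweep L Δ ξ (i + 1)` is obtained from `sweep L Δ ξ i` by the step for the equation with
(zero-based) index `i`. Only the indices `0, …, N` are used. -/
def sweep (L : ℕ) (Δ : ℝ) (ξ : Fin N → ℂ) : ℕ → (Fin N → ℂ)
  | 0 => ξ
  | i + 1 =>
      if h : i < N then kaczmarzStep L Δ ⟨i, h⟩ (sweep L Δ ξ i) else sweep L Δ ξ i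

/-- The Newton-Kaczmarz sequence `ξ(n)` with base point `ξ(0) = η(k)`. -/
def kaczmarzSeq (L : ℕ) (Δ : ℝ) (k : Fin N → Fin L) : ℕ → (Fin N → ℂ)
  | 0 => basePoint L k
  | n + 1 => sweep L Δ (kaczmarzSeq L Δ k n) N

end XXZ

end

/-! At `Δ = 0`, where no denominator vanishes, every Bethe factor is `1`. The equations decouple
into `ξᵢ ^ L + (-1) ^ N = 0`, each gradient is supported on its own coordinate, and one sweep near
`η(k)` is the one-variable Newton map in every coordinate (`eventually_sweep_zero_apply`). Since
`η(k)` consists of simple roots, it is a fixed point at which the sweep has zero derivative.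

The sweep is jointly C¹ in `(Δ, ξ)` over ℝ (conjugation rules out ℂ). Hence for small `Δ` it
contracts a fixed ball around `η(k)`, and the iteration converges to a fixed point there.

A fixed point solves the equations because the increments of a sweep are multiples of the conjugate
gradients at the intermediate points. These gradients are nearly diagonal, hence independent, so
increments with sum zero all vanish (`betheF_eq_zero_of_sweep_eq`). Distinctness and nonvanishing
denominators are open conditions. -/

/-- A parametrised map `G` which is strictly differentiable at `(t₀, p)`, fixes `p` at the parameter
`t₀`, and whose partial derivative along the space variable vanishes there, has for nearby parameters
an attracting fixed point near `p`, to which the iteration started at `p` converges. Any local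
property at `(t₀, p)` holds along the iteration and at its limit. -/
theorem HasStrictFDerivAt.eventually_tendsto_iterate_fixedPoint
    {V E : Type*} [NormedAddCommGroup V] [NormedSpace ℝ V]
    [NormedAddCommGroup E] [NormedSpace ℝ E] [CompleteSpace E]
    {G : V × E → E} {D : V × E →L[ℝ] E} {t₀ : V} {p : E}
    (hG : HasStrictFDerivAt G D (t₀, p)) (hD : ∀ v, D (0, v) = 0) (hp : G (t₀, p) = p)
    {P : V × E → Prop} (hP : ∀ᶠ x in 𝓝 (t₀, p), P x) :
    ∀ᶠ t in 𝓝 t₀, (∀ n : ℕ, P (t, (fun x => G (t, x))^[n] p)) ∧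
      ∃ ξ, Tendsto (fun n : ℕ => (fun x => G (t, x))^[n] p) atTop (𝓝 ξ) ∧
        G (t, ξ) = ξ ∧ P (t, ξ) := by
  obtain ⟨s, hs, hGs⟩ := hG.approximates_deriv_on_nhds (c := 1 / 2) (Or.inr (by norm_num))
  have hev : ∀ᶠ x in 𝓝 (t₀, p), x ∈ s ∧ P x := (eventually_mem_set.2 hs).and hP
  rw [nhds_prod_eq] at hev
  obtain ⟨u, hu, v, hv, huv⟩ := eventually_prod_iff.1 hev
  obtain ⟨r, hr, hrv⟩ := Metric.nhds_basis_closedBall.mem_iff.1 hv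
  have hcont : Tendsto (fun t => G (t, p)) (𝓝 t₀) (𝓝 p) := by
    have h1 : ContinuousAt (fun t => G (t, p)) t₀ :=
      ContinuousAt.comp (f := fun t => (t, p)) (g := G) hG.hasFDerivAt.continuousAt (by fun_prop)
    simpa [ContinuousAt, hp] using h1
  -- With contraction ratio `1 / 2`, moving the centre by at most `r / 2` keeps the ball of radius
  -- `r` invariant.
  filter_upwards [hu, hcont (Metric.closedBall_mem_nhds p (half_pos hr))] with t htu htp
  have hlip : ∀ x ∈ Metric.closedBall p r, ∀ y ∈ Metric.closedBall p r,
      dist (G (t, x)) (G (t, y)) ≤ 1 / 2 * dist x y := by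
    intro x hx y hy
    have h := hGs _ (huv htu (hrv hx)).1 _ (huv htu (hrv hy)).1
    simp only [Prod.mk_sub_mk, sub_self, hD, sub_zero] at h
    rw [dist_eq_norm, dist_eq_norm]
    simpa using h
  have hmaps : Set.MapsTo (fun x => G (t, x)) (Metric.closedBall p r) (Metric.closedBall p r) := by
    intro x hx
    have h1 := hlip x hx p (Metric.mem_closedBall_self hr.le)
    have h2 : dist (G (t, p)) p ≤ r / 2 := htp
    have h3 := dist_triangle (G (t, x)) (G (t, p)) p
    have h4 : dist x p ≤ r := hx
    show dist (G (t, x)) p ≤ r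
    linarith
  have hcontr : ContractingWith (1 / 2) (hmaps.restrict _ _ _) := by
    refine ⟨by norm_num, LipschitzWith.of_dist_le_mul fun x y => ?_⟩
    have h := hlip x x.2 y y.2
    rw [Subtype.dist_eq, Subtype.dist_eq]
    simpa using h
  obtain ⟨ξ, hξ, hfix, hlim, -⟩ := ContractingWith.exists_fixedPoint'
    Metric.isClosed_closedBall.isComplete hmaps hcontr
    (Metric.mem_closedBall_self hr.le) (edist_ne_top _ _)
  exact ⟨fun n => (huv htu (hrv (hmaps.iterate n (Metric.mem_closedBall_self hr.le)))).2,
    ξ, hlim, hfix, (huv htu (hrv hξ)).2⟩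

namespace XXZ

/-! ### The roots `η(κ)` -/

theorem rootEta_ne_zero (N L : ℕ) (k : Fin L) : rootEta N L k ≠ 0 := by
  unfold rootEta
  split_ifs <;> exact Complex.exp_ne_zero _

theorem rootEta_pow (N L : ℕ) (k : Fin L) : rootEta N L k ^ L + (-1) ^ N = 0 := by
  have hL : (L : ℂ) ≠ 0 := Nat.cast_ne_zero.2 (Nat.ne_of_gt k.pos)
  unfold rootEta
  split_ifs with h
  · rw [← Complex.exp_nat_mul, h.neg_one_pow]
    have : (L : ℂ) * (Real.pi * Complex.I * (2 * ((k : ℕ) : ℂ) + 1) / L)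
        = Real.pi * Complex.I + ((k : ℕ) : ℂ) * (2 * Real.pi * Complex.I) := by
      field_simp
      ring
    rw [this, Complex.exp_add, Complex.exp_pi_mul_I, Complex.exp_nat_mul_two_pi_mul_I]
    ring
  · rw [← Complex.exp_nat_mul, (Nat.not_even_iff_odd.1 h).neg_one_pow]
    have : (L : ℂ) * (2 * Real.pi * Complex.I * ((k : ℕ) : ℂ) / L)
        = ((k : ℕ) : ℂ) * (2 * Real.pi * Complex.I) := by
      field_simp
    rw [this, Complex.exp_nat_mul_two_pi_mul_I]
    ring

theorem rootEta_injective (N L : ℕ) : Function.Injective (rootEta N L) := by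
  intro a b hab
  have hL : (L : ℂ) ≠ 0 := Nat.cast_ne_zero.2 (Nat.ne_of_gt a.pos)
  have hpi : (Real.pi : ℂ) ≠ 0 := Complex.ofReal_ne_zero.2 Real.pi_ne_zero
  have key : ∃ n : ℤ, ((a : ℕ) : ℂ) = ((b : ℕ) : ℂ) + n * L := by
    unfold rootEta at hab
    split_ifs at hab with h <;>
    · obtain ⟨n, hn⟩ := Complex.exp_eq_exp_iff_exists_int.1 hab
      refine ⟨n, ?_⟩
      field_simp at hn
      first
        | linear_combination hn
        | linear_combination (1 / 2) * hn
  obtain ⟨n, hn⟩ := key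
  have hn' : ((a : ℕ) : ℤ) = ((b : ℕ) : ℤ) + n * L := by exact_mod_cast hn
  have ha : ((a : ℕ) : ℤ) < L := by exact_mod_cast a.2
  have hb : ((b : ℕ) : ℤ) < L := by exact_mod_cast b.2
  have hmod := congrArg (· % (L : ℤ)) hn'
  simp only [Int.add_mul_emod_self_right] at hmod
  rw [Int.emod_eq_of_lt (by positivity) ha, Int.emod_eq_of_lt (by positivity) hb] at hmod
  exact Fin.ext (by exact_mod_cast hmod)

variable {N : ℕ}

/-! ### Smoothness in the anisotropy and the point -/

/-- The function `betheF` with a complex anisotropy. -/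
noncomputable def complexBetheF (L : ℕ) (i : Fin N) (z : ℂ) (ξ : Fin N → ℂ) : ℂ :=
  ξ i ^ L + (-1) ^ N * ∏ j ∈ Finset.univ.erase i,
    (1 + ξ i * ξ j - 2 * z * ξ i) / (1 + ξ i * ξ j - 2 * z * ξ j)

/-- Complexifying `Δ` makes joint regularity over ℂ available; order 2 leaves the complex gradient
jointly C¹. -/
theorem contDiffAt_complexBetheF (L : ℕ) (i : Fin N) {Δ : ℝ} {ξ : Fin N → ℂ}
    (h : BetheDefined Δ ξ) :
    ContDiffAt ℂ 2 (Function.uncurry (complexBetheF L i)) ((Δ : ℂ), ξ) := by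
  have hc : ∀ j : Fin N, ContDiffAt ℂ 2 (fun x : ℂ × (Fin N → ℂ) => x.2 j) ((Δ : ℂ), ξ) :=
    fun j => contDiffAt_pi.1 contDiffAt_snd j
  have hz : ContDiffAt ℂ 2 (fun x : ℂ × (Fin N → ℂ) => x.1) ((Δ : ℂ), ξ) := contDiffAt_fst
  refine ((hc i).pow L).add (contDiffAt_const.mul (contDiffAt_prod fun j hj => ?_))
  refine ContDiffAt.div ?_ ?_ (h i j (Finset.ne_of_mem_erase hj).symm)
  · exact (contDiffAt_const.add ((hc i).mul (hc j))).sub ((contDiffAt_const.mul hz).mul (hc i))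
  · exact (contDiffAt_const.add ((hc i).mul (hc j))).sub ((contDiffAt_const.mul hz).mul (hc j))

theorem contDiffAt_ofReal_prod (x : ℝ × (Fin N → ℂ)) :
    ContDiffAt ℝ 1 (fun x : ℝ × (Fin N → ℂ) => ((x.1 : ℂ), x.2)) x :=
  (Complex.ofRealCLM.contDiff.contDiffAt.comp x contDiffAt_fst).prodMk contDiffAt_snd

theorem contDiffAt_betheF (L : ℕ) (i : Fin N) {x : ℝ × (Fin N → ℂ)} (h : BetheDefined x.1 x.2) :
    ContDiffAt ℝ 1 (fun x : ℝ × (Fin N → ℂ) => betheF L x.1 i x.2) x := by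
  have h1 : ContDiffAt ℝ 1 (Function.uncurry (complexBetheF L i)) ((x.1 : ℂ), x.2) :=
    ((contDiffAt_complexBetheF L i h).of_le (by norm_num)).restrict_scalars ℝ
  exact h1.comp x (contDiffAt_ofReal_prod x)

theorem contDiffAt_betheJ (L : ℕ) (i j : Fin N) {x : ℝ × (Fin N → ℂ)}
    (h : BetheDefined x.1 x.2) :
    ContDiffAt ℝ 1 (fun x : ℝ × (Fin N → ℂ) => betheJ L x.1 i x.2 j) x := by
  have h1 : ContDiffAt ℂ 1 (fun y : ℂ × (Fin N → ℂ) => fderiv ℂ (complexBetheF L i y.1) y.2)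
      ((x.1 : ℂ), x.2) := by
    refine ContDiffAt.fderiv (n := 2) (f := fun y : ℂ × (Fin N → ℂ) => complexBetheF L i y.1)
      (g := fun y : ℂ × (Fin N → ℂ) => y.2) ?_ contDiffAt_snd (by norm_num)
    exact (contDiffAt_complexBetheF L i h).comp (((x.1 : ℂ), x.2), x.2)
      (f := fun w : (ℂ × (Fin N → ℂ)) × (Fin N → ℂ) => (w.1.1, w.2))
      (by fun_prop)
  have h2 := (h1.clm_apply (contDiffAt_const (c := (Pi.single j 1 : Fin N → ℂ)))).restrict_scalars ℝ
  exact h2.comp x (contDiffAt_ofReal_prod x)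

theorem sum_norm_sq_betheJ_ne_zero {L : ℕ} {i : Fin N} {Δ : ℝ} {ξ : Fin N → ℂ}
    (h : betheJ L Δ i ξ ≠ 0) : (∑ m, ‖betheJ L Δ i ξ m‖ ^ 2 : ℝ) ≠ 0 := by
  contrapose! h
  rw [Finset.sum_eq_zero_iff_of_nonneg fun _ _ => by positivity] at h
  funext m
  simpa using h m (Finset.mem_univ m)

theorem contDiffAt_kaczmarzStep (L : ℕ) (i : Fin N) {x : ℝ × (Fin N → ℂ)}
    (h : BetheDefined x.1 x.2) (hJ : betheJ L x.1 i x.2 ≠ 0) :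
    ContDiffAt ℝ 1 (fun x : ℝ × (Fin N → ℂ) => kaczmarzStep L x.1 i x.2) x := by
  refine contDiffAt_pi.2 fun j => ?_
  have hs : ContDiffAt ℝ 1
      (fun x : ℝ × (Fin N → ℂ) => ((∑ m, ‖betheJ L x.1 i x.2 m‖ ^ 2 : ℝ) : ℂ)) x :=
    Complex.ofRealCLM.contDiff.contDiffAt.comp x (f := fun x : ℝ × (Fin N → ℂ) =>
      ∑ m, ‖betheJ L x.1 i x.2 m‖ ^ 2) (ContDiffAt.sum fun m _ => (contDiffAt_betheJ L i m h).norm_sq ℝ)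
  refine (contDiffAt_pi.1 contDiffAt_snd j).sub (ContDiffAt.mul ?_ ?_)
  · simp only [div_eq_mul_inv]
    exact (contDiffAt_betheF L i h).mul
      (hs.inv (Complex.ofReal_ne_zero.2 (sum_norm_sq_betheJ_ne_zero hJ)))
  · exact Complex.conjCLE.contDiff.contDiffAt.comp x (contDiffAt_betheJ L i j h)

theorem eventually_betheDefined {x : ℝ × (Fin N → ℂ)} (h : BetheDefined x.1 x.2) :
    ∀ᶠ y in 𝓝 x, BetheDefined y.1 y.2 := by
  unfold BetheDefined at h ⊢
  simp only [eventually_all]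
  intro i j hij
  have : ContinuousAt (fun y : ℝ × (Fin N → ℂ) => betheDen y.1 y.2 i j) x := by
    unfold betheDen
    fun_prop
  exact this.eventually_ne (h i j hij)

/-! ### Decoupling at zero anisotropy -/

/-- At zero anisotropy the equations decouple. -/
theorem betheF_zero {L : ℕ} (i : Fin N) {ξ : Fin N → ℂ} (h : BetheDefined 0 ξ) :
    betheF L 0 i ξ = ξ i ^ L + (-1) ^ N := by
  unfold betheF betheProd
  rw [Finset.prod_eq_one, mul_one]
  intro j hj
  have := h i j (Finset.ne_of_mem_erase hj).symm
  simp only [betheDen, Complex.ofReal_zero, mul_zero, zero_mul, sub_zero] at this ⊢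
  exact div_self this

theorem betheJ_zero {L : ℕ} (i : Fin N) {ξ : Fin N → ℂ} (h : BetheDefined 0 ξ) :
    betheJ L 0 i ξ = Pi.single i (L * ξ i ^ (L - 1)) := by
  have hev : ∀ᶠ ζ in 𝓝 ξ, BetheDefined 0 ζ :=
    (Continuous.prodMk_right (0 : ℝ)).continuousAt.eventually
      (eventually_betheDefined (x := ((0 : ℝ), ξ)) h)
  have heq : betheF L 0 i =ᶠ[𝓝 ξ] fun ζ => ζ i ^ L + (-1) ^ N := hev.mono fun ζ => betheF_zero i
  have hd : HasFDerivAt (fun ζ : Fin N → ℂ => ζ i ^ L + (-1) ^ N)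
      ((L * ξ i ^ (L - 1)) • (ContinuousLinearMap.proj i : (Fin N → ℂ) →L[ℂ] ℂ)) ξ := by
    have := ((hasDerivAt_pow L (ξ i)).comp_hasFDerivAt ξ
      (ContinuousLinearMap.proj i : (Fin N → ℂ) →L[ℂ] ℂ).hasFDerivAt).add_const ((-1) ^ N)
    exact this
  funext j
  unfold betheJ
  rw [heq.fderiv_eq, hd.fderiv]
  by_cases hij : j = i
  · subst hij; simp
  · simp [hij, Ne.symm hij]

/-- The Newton map of the polynomial `z ^ L + c`. -/
noncomputable def newtonMap (L : ℕ) (c z : ℂ) : ℂ := z - (z ^ L + c) / (L * z ^ (L - 1))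

/-- At a simple root the Newton quotient has derivative `1`, cancelling that of the identity. -/
theorem hasDerivAt_newtonMap {L : ℕ} (hL : L ≠ 0) {c z : ℂ} (hz : z ≠ 0) (hzc : z ^ L + c = 0) :
    HasDerivAt (newtonMap L c) 0 z := by
  have hL' : (L : ℂ) * z ^ (L - 1) ≠ 0 :=
    mul_ne_zero (Nat.cast_ne_zero.2 hL) (pow_ne_zero _ hz)
  have h := (hasDerivAt_id z).sub (((hasDerivAt_pow L z).add_const c).div
    ((hasDerivAt_pow (L - 1) z).const_mul (L : ℂ)) hL')
  rw [hzc, zero_mul, sub_zero, ← sq, div_self (pow_ne_zero 2 hL'), sub_self] at h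
  exact h

/-- With gradient `w` in the single coordinate `i`, the factor `conj w / ‖w‖ ^ 2` is `1 / w`. -/
theorem kaczmarzStep_zero {L : ℕ} (i : Fin N) {ξ : Fin N → ℂ} (h : BetheDefined 0 ξ) :
    kaczmarzStep L 0 i ξ = Function.update ξ i (newtonMap L ((-1) ^ N) (ξ i)) := by
  have hsum : (∑ m, ‖betheJ L 0 i ξ m‖ ^ 2 : ℝ) = ‖(L * ξ i ^ (L - 1) : ℂ)‖ ^ 2 := by
    rw [betheJ_zero i h, Finset.sum_eq_single i]
    · simp
    · intro j _ hj; simp [hj]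
    · simp
  funext j
  unfold kaczmarzStep
  rw [hsum, betheF_zero i h, betheJ_zero i h]
  by_cases hj : j = i
  · subst hj
    simp only [Pi.single_eq_same, Function.update_self, newtonMap]
    set w : ℂ := L * ξ j ^ (L - 1)
    -- For `w = 0` both corrections are zero, division by zero being zero.
    rcases eq_or_ne w 0 with hw | hw
    · simp [hw]
    · have : ((‖w‖ ^ 2 : ℝ) : ℂ) = w * (starRingEnd ℂ) w := by
        rw [Complex.mul_conj, Complex.normSq_eq_norm_sq]
      have hw' : (starRingEnd ℂ) w ≠ 0 := by simpa using hw
      rw [this]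
      field_simp
  · simp [hj]

/-! ### Fixed points of the sweep -/

theorem sweep_succ (L : ℕ) (Δ : ℝ) (ξ : Fin N → ℂ) (i : Fin N) :
    sweep L Δ ξ (i + 1) = kaczmarzStep L Δ i (sweep L Δ ξ i) := by
  simp [sweep]

theorem sweep_eq_self {L : ℕ} {Δ : ℝ} {ξ : Fin N → ℂ} :
    ∀ m : ℕ, (∀ i : Fin N, (i : ℕ) < m → kaczmarzStep L Δ i ξ = ξ) → sweep L Δ ξ m = ξ
  | 0, _ => rfl
  | m + 1, h => by
    have ih := sweep_eq_self m fun i hi => h i (by omega)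
    rw [sweep]
    split_ifs with hm
    · rw [ih, h ⟨m, hm⟩ (Nat.lt_succ_self m)]
    · exact ih

/-- The conjugate gradients used in one sweep, as the rows of a matrix. -/
noncomputable def sweepMatrix (L : ℕ) (Δ : ℝ) (ξ : Fin N → ℂ) : Matrix (Fin N) (Fin N) ℂ :=
  Matrix.of fun i j => (starRingEnd ℂ) (betheJ L Δ i (sweep L Δ ξ i) j)

theorem sweep_sub_self (L : ℕ) (Δ : ℝ) (ξ : Fin N → ℂ) :
    sweep L Δ ξ N - ξ = -Matrix.vecMul
      (fun i : Fin N => betheF L Δ i (sweep L Δ ξ i) /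
        ((∑ m, ‖betheJ L Δ i (sweep L Δ ξ i) m‖ ^ 2 : ℝ) : ℂ)) (sweepMatrix L Δ ξ) := by
  have h := Finset.sum_range_sub (sweep L Δ ξ) N
  rw [Finset.sum_range] at h
  rw [show sweep L Δ ξ N - ξ = sweep L Δ ξ N - sweep L Δ ξ 0 from rfl, ← h]
  funext j
  rw [Finset.sum_apply, Pi.neg_apply, Matrix.vecMul, dotProduct, ← Finset.sum_neg_distrib]
  refine Finset.sum_congr rfl fun i _ => ?_
  rw [Pi.sub_apply, sweep_succ]
  simp [kaczmarzStep, sweepMatrix]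

/-- A fixed point of the sweep whose gradients are linearly independent is a common zero. -/
theorem betheF_eq_zero_of_sweep_eq {L : ℕ} {Δ : ℝ} {ξ : Fin N → ℂ} (hfix : sweep L Δ ξ N = ξ)
    (hJ : ∀ i : Fin N, betheJ L Δ i (sweep L Δ ξ i) ≠ 0) (hdet : (sweepMatrix L Δ ξ).det ≠ 0)
    (i : Fin N) : betheF L Δ i ξ = 0 := by
  have h := sweep_sub_self L Δ ξ
  rw [hfix, sub_self, eq_comm, neg_eq_zero] at h
  have hc := Matrix.eq_zero_of_vecMul_eq_zero hdet h
  have hF : ∀ i : Fin N, betheF L Δ i (sweep L Δ ξ i) = 0 := fun i =>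
    (div_eq_zero_iff.1 (congrFun hc i)).resolve_right
      (Complex.ofReal_ne_zero.2 (sum_norm_sq_betheJ_ne_zero (hJ i)))
  -- With zero residuals no step moves the point, so the residuals at the intermediate points are
  -- those at `ξ`.
  have hs : ∀ m : ℕ, sweep L Δ ξ m = ξ := by
    intro m
    induction m with
    | zero => rfl
    | succ m ih =>
      rw [sweep]
      split_ifs with hm
      · have h0 : betheF L Δ ⟨m, hm⟩ ξ = 0 := ih ▸ hF ⟨m, hm⟩
        funext j
        simp only [kaczmarzStep, ih, h0, zero_div, zero_mul, sub_zero]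
      · exact ih
  simpa [hs] using hF i

theorem isBetheSolution_of_betheF_eq_zero {L : ℕ} {Δ : ℝ} {ξ : Fin N → ℂ}
    (hdef : BetheDefined Δ ξ) (hF : ∀ i, betheF L Δ i ξ = 0) : IsBetheSolution L Δ ξ := by
  refine ⟨hdef, fun i => ?_⟩
  have h := hF i
  obtain ⟨n, rfl⟩ : ∃ n, N = n + 1 := ⟨N - 1, by have := i.pos; omega⟩
  rw [betheF, pow_succ] at h
  rw [Nat.add_sub_cancel]
  linear_combination h

/-! ### Perturbation from the decoupled solution -/

section Decoupled

variable {L : ℕ} {p : Fin N → ℂ}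

theorem kaczmarzStep_zero_eq_self (hdef : BetheDefined 0 p) (hroot : ∀ i, p i ^ L + (-1) ^ N = 0)
    (i : Fin N) : kaczmarzStep L 0 i p = p := by
  rw [kaczmarzStep_zero i hdef, newtonMap, hroot i, zero_div, sub_zero, Function.update_eq_self]

theorem sweep_zero_eq_self (hdef : BetheDefined 0 p) (hroot : ∀ i, p i ^ L + (-1) ^ N = 0)
    (m : ℕ) : sweep L 0 p m = p :=
  sweep_eq_self m fun i _ => kaczmarzStep_zero_eq_self hdef hroot i

theorem betheJ_zero_ne_zero (hL : L ≠ 0) (hdef : BetheDefined 0 p) (hp : ∀ i, p i ≠ 0)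
    (i : Fin N) : betheJ L 0 i p ≠ 0 := by
  rw [betheJ_zero i hdef, Ne, Pi.single_eq_zero_iff]
  exact mul_ne_zero (Nat.cast_ne_zero.2 hL) (pow_ne_zero _ (hp i))

theorem contDiffAt_sweep (hL : L ≠ 0) (hdef : BetheDefined 0 p) (hp : ∀ i, p i ≠ 0)
    (hroot : ∀ i, p i ^ L + (-1) ^ N = 0) (m : ℕ) :
    ContDiffAt ℝ 1 (fun x : ℝ × (Fin N → ℂ) => sweep L x.1 x.2 m) (0, p) := by
  induction m with
  | zero => exact contDiffAt_snd
  | succ m ih =>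
    by_cases hm : m < N
    · simp only [sweep, hm, dif_pos]
      -- All intermediate points over `(0, p)` are `p` itself, where the step is regular.
      have hpt : ((0 : ℝ), sweep L 0 p m) = (0, p) := by rw [sweep_zero_eq_self hdef hroot]
      have h1 : ContDiffAt ℝ 1 (fun x : ℝ × (Fin N → ℂ) => kaczmarzStep L x.1 ⟨m, hm⟩ x.2)
          ((0 : ℝ), sweep L 0 p m) := by
        rw [hpt]
        exact contDiffAt_kaczmarzStep L ⟨m, hm⟩ hdef (betheJ_zero_ne_zero hL hdef hp _)
      exact h1.comp (f := fun x : ℝ × (Fin N → ℂ) => (x.1, sweep L x.1 x.2 m)) (0, p)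
        (contDiffAt_fst.prodMk ih)
    · simpa only [sweep, hm, dif_neg, not_false_eq_true] using ih

theorem tendsto_prod_sweep (hL : L ≠ 0) (hdef : BetheDefined 0 p) (hp : ∀ i, p i ≠ 0)
    (hroot : ∀ i, p i ^ L + (-1) ^ N = 0) (m : ℕ) :
    Tendsto (fun x : ℝ × (Fin N → ℂ) => (x.1, sweep L x.1 x.2 m)) (𝓝 (0, p)) (𝓝 (0, p)) := by
  have h := (continuousAt_fst.prodMk (contDiffAt_sweep hL hdef hp hroot m).continuousAt).tendsto
  simpa only [sweep_zero_eq_self hdef hroot] using h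

theorem eventually_sweep_zero_apply (hL : L ≠ 0) (hdef : BetheDefined 0 p) (hp : ∀ i, p i ≠ 0)
    (hroot : ∀ i, p i ^ L + (-1) ^ N = 0) (m : ℕ) :
    ∀ᶠ ξ in 𝓝 p, ∀ j : Fin N,
      sweep L 0 ξ m j = if (j : ℕ) < m then newtonMap L ((-1) ^ N) (ξ j) else ξ j := by
  induction m with
  | zero => simp [sweep]
  | succ m ih =>
    -- The decoupled form of a step needs its own starting point, not only `ξ`, to lie in the
    -- domain.
    have hdef' : ∀ᶠ ξ in 𝓝 p, BetheDefined 0 (sweep L 0 ξ m) :=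
      ((tendsto_prod_sweep hL hdef hp hroot m).comp
        (Continuous.prodMk_right (0 : ℝ)).continuousAt.tendsto).eventually
        (eventually_betheDefined (x := ((0 : ℝ), p)) hdef)
    filter_upwards [ih, hdef'] with ξ hξ hd j
    rw [sweep]
    split_ifs with hm hj hj
    · rw [kaczmarzStep_zero _ hd]
      by_cases h : j = ⟨m, hm⟩
      · subst h
        simp [hξ]
      · have hne : (j : ℕ) ≠ m := fun h' => h (Fin.ext h')
        rw [Function.update_of_ne h, hξ, if_pos (by omega)]
    · rw [kaczmarzStep_zero _ hd, Function.update_of_ne, hξ, if_neg (by omega)]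
      rintro rfl
      exact hj (Nat.lt_succ_self m)
    · rw [hξ, if_pos (by omega)]
    · rw [hξ, if_neg (by omega)]

theorem hasFDerivAt_sweep_zero (hL : L ≠ 0) (hdef : BetheDefined 0 p) (hp : ∀ i, p i ≠ 0)
    (hroot : ∀ i, p i ^ L + (-1) ^ N = 0) :
    HasFDerivAt (fun ξ => sweep L 0 ξ N) (0 : (Fin N → ℂ) →L[ℝ] (Fin N → ℂ)) p := by
  have h : HasFDerivAt (fun (ξ : Fin N → ℂ) j => newtonMap L ((-1) ^ N) (ξ j))
      (0 : (Fin N → ℂ) →L[ℂ] (Fin N → ℂ)) p := by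
    refine hasFDerivAt_pi'.2 fun j => ?_
    have hj := (hasDerivAt_newtonMap hL (hp j) (hroot j)).comp_hasFDerivAt p
      (ContinuousLinearMap.proj j : (Fin N → ℂ) →L[ℂ] ℂ).hasFDerivAt
    refine HasFDerivAt.congr_fderiv (f := fun x : Fin N → ℂ => newtonMap L ((-1) ^ N) (x j)) hj ?_
    ext v
    exact zero_mul _
  refine (h.restrictScalars ℝ).congr_of_eventuallyEq ?_
  filter_upwards [eventually_sweep_zero_apply hL hdef hp hroot N] with ξ hξ
  funext j
  rw [hξ, if_pos j.2]

theorem fderiv_sweep_apply_zero (hL : L ≠ 0) (hdef : BetheDefined 0 p) (hp : ∀ i, p i ≠ 0)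
    (hroot : ∀ i, p i ^ L + (-1) ^ N = 0) (v : Fin N → ℂ) :
    fderiv ℝ (fun x : ℝ × (Fin N → ℂ) => sweep L x.1 x.2 N) (0, p) (0, v) = 0 := by
  have h1 := ((contDiffAt_sweep hL hdef hp hroot N).differentiableAt one_ne_zero).hasFDerivAt
  have h2 := h1.comp p (hasFDerivAt_prodMk_right (𝕜 := ℝ) (0 : ℝ) p)
  have h3 := h2.unique (hasFDerivAt_sweep_zero hL hdef hp hroot)
  simpa using DFunLike.congr_fun h3 v

theorem eventually_sweep_regular (hL : L ≠ 0) (hdef : BetheDefined 0 p) (hp : ∀ i, p i ≠ 0)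
    (hroot : ∀ i, p i ^ L + (-1) ^ N = 0) :
    ∀ᶠ x : ℝ × (Fin N → ℂ) in 𝓝 (0, p), ∀ i : Fin N,
      BetheDefined x.1 (sweep L x.1 x.2 i) ∧ betheJ L x.1 i (sweep L x.1 x.2 i) ≠ 0 := by
  refine eventually_all.2 fun i => (tendsto_prod_sweep hL hdef hp hroot i).eventually
    (p := fun y : ℝ × (Fin N → ℂ) => BetheDefined y.1 y.2 ∧ betheJ L y.1 i y.2 ≠ 0) ?_
  refine (eventually_betheDefined (x := ((0 : ℝ), p)) hdef).and ?_
  have hc : ContinuousAt (fun y : ℝ × (Fin N → ℂ) => betheJ L y.1 i y.2) (0, p) :=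
    continuousAt_pi.2 fun j => (contDiffAt_betheJ L i j (x := ((0 : ℝ), p)) hdef).continuousAt
  exact hc.eventually_ne (betheJ_zero_ne_zero hL hdef hp i)

theorem eventually_det_sweepMatrix_ne_zero (hL : L ≠ 0) (hdef : BetheDefined 0 p)
    (hp : ∀ i, p i ≠ 0) (hroot : ∀ i, p i ^ L + (-1) ^ N = 0) :
    ∀ᶠ x : ℝ × (Fin N → ℂ) in 𝓝 (0, p), (sweepMatrix L x.1 x.2).det ≠ 0 := by
  have hc : Tendsto (fun x : ℝ × (Fin N → ℂ) => sweepMatrix L x.1 x.2) (𝓝 (0, p))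
      (𝓝 (Matrix.diagonal fun i => (starRingEnd ℂ) (L * p i ^ (L - 1)))) := by
    refine tendsto_pi_nhds.2 fun i => tendsto_pi_nhds.2 fun j => ?_
    have h1 := (contDiffAt_betheJ L i j (x := ((0 : ℝ), p)) hdef).continuousAt.tendsto.comp
      (tendsto_prod_sweep hL hdef hp hroot i)
    have h2 := (Complex.continuous_conj.tendsto _).comp h1
    have h3 : (starRingEnd ℂ) (betheJ L 0 i p j) =
        Matrix.diagonal (fun i => (starRingEnd ℂ) (L * p i ^ (L - 1))) i j := by
      rw [betheJ_zero i hdef]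
      by_cases hij : i = j
      · subst hij; simp
      · simp [hij, Ne.symm hij]
    rw [← h3]
    exact h2
  have hdet := ((continuous_id.matrix_det).tendsto
    (Matrix.diagonal fun i => (starRingEnd ℂ) ((L : ℂ) * p i ^ (L - 1)))).comp hc
  refine hdet.eventually_ne ?_
  simp only [id, Matrix.det_diagonal]
  refine Finset.prod_ne_zero_iff.2 fun i _ => ?_
  rw [Ne, map_eq_zero]
  exact mul_ne_zero (Nat.cast_ne_zero.2 hL) (pow_ne_zero _ (hp i))

end Decoupled

theorem eventually_injective {p : Fin N → ℂ} (hp : Function.Injective p) :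
    ∀ᶠ ξ in 𝓝 p, Function.Injective ξ := by
  have h : ∀ᶠ ξ in 𝓝 p, ∀ i j : Fin N, i ≠ j → ξ i ≠ ξ j := by
    simp only [eventually_all]
    intro i j hij
    exact (isOpen_ne_fun (continuous_apply i) (continuous_apply j)).mem_nhds (hp.ne hij)
  exact h.mono fun ξ hξ i j hij => by_contra fun hne => hξ i j hne hij

theorem kaczmarzSeq_eq_iterate (L : ℕ) (Δ : ℝ) (k : Fin N → Fin L) (n : ℕ) :
    kaczmarzSeq L Δ k n = (fun ξ => sweep L Δ ξ N)^[n] (basePoint L k) := by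
  induction n with
  | zero => rfl
  | succ n ih => rw [Function.iterate_succ_apply', ← ih, kaczmarzSeq]

end XXZ

theorem lemma4p3 (N L : ℕ) (k : Fin N → Fin L) (hk : Function.Injective k)
    (hη : ∀ i j, i ≠ j → 1 + XXZ.rootEta N L (k i) * XXZ.rootEta N L (k j) ≠ 0) :
    ∃ ε : ℝ, 0 < ε ∧ ∀ Δ : ℝ, |Δ| < ε →
      -- every step of the recursion is well defined
      (∀ (n : ℕ) (i : Fin N),
        XXZ.BetheDefined Δ (XXZ.sweep L Δ (XXZ.kaczmarzSeq L Δ k n) i) ∧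
        XXZ.betheJ L Δ i (XXZ.sweep L Δ (XXZ.kaczmarzSeq L Δ k n) i) ≠ 0) ∧
      -- the sequence converges to a solution with pairwise distinct entries
      ∃ ξ : Fin N → ℂ,
        Tendsto (XXZ.kaczmarzSeq L Δ k) atTop (𝓝 ξ) ∧
        Function.Injective ξ ∧
        XXZ.IsBetheSolution L Δ ξ := by
  set p := XXZ.basePoint L k with hp_def
  have hdef : XXZ.BetheDefined 0 p := by
    intro i j hij
    simpa [XXZ.betheDen, hp_def, XXZ.basePoint] using hη i j hij
  have hp : ∀ i, p i ≠ 0 := fun i => XXZ.rootEta_ne_zero N L (k i)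
  have hroot : ∀ i, p i ^ L + (-1) ^ N = 0 := fun i => XXZ.rootEta_pow N L (k i)
  have hinj : Function.Injective p := (XXZ.rootEta_injective N L).comp hk
  -- Without an index `i`, nothing forces `L ≠ 0`; for `N = 0` the space is a single point.
  rcases Nat.eq_zero_or_pos N with rfl | hN
  · refine ⟨1, one_pos, fun Δ _ => ⟨fun _ i => i.elim0, p, ?_, hinj, fun i => i.elim0,
      fun i => i.elim0⟩⟩
    rw [Subsingleton.elim (XXZ.kaczmarzSeq L Δ k) fun _ => p]
    exact tendsto_const_nhds
  have hL : L ≠ 0 := Nat.ne_of_gt (k ⟨0, hN⟩).pos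
  have hev := (((XXZ.contDiffAt_sweep hL hdef hp hroot N).hasStrictFDerivAt
    one_ne_zero).eventually_tendsto_iterate_fixedPoint
    (XXZ.fderiv_sweep_apply_zero hL hdef hp hroot) (XXZ.sweep_zero_eq_self hdef hroot N)
    (((XXZ.eventually_sweep_regular hL hdef hp hroot).and
      (XXZ.eventually_det_sweepMatrix_ne_zero hL hdef hp hroot)).and
      ((XXZ.eventually_betheDefined (x := ((0 : ℝ), p)) hdef).and
        ((continuous_snd.tendsto ((0 : ℝ), p)).eventually
          (XXZ.eventually_injective hinj)))))
  obtain ⟨ε, hε, h⟩ := Metric.eventually_nhds_iff.1 hev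
  refine ⟨ε, hε, fun Δ hΔ => ?_⟩
  obtain ⟨hreg, ξ, hlim, hfix, ⟨hregξ, hdet⟩, hdefξ, hinjξ⟩ := h (y := Δ) (by simpa using hΔ)
  have hseq : XXZ.kaczmarzSeq L Δ k = fun n => (fun ξ => XXZ.sweep L Δ ξ N)^[n] p :=
    funext (XXZ.kaczmarzSeq_eq_iterate L Δ k)
  refine ⟨fun n i => ?_, ξ, ?_, hinjξ, XXZ.isBetheSolution_of_betheF_eq_zero hdefξ
    (XXZ.betheF_eq_zero_of_sweep_eq hfix (fun i => (hregξ i).2) hdet)⟩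
  · rw [hseq]
    exact (hreg n).1.1 i
  · rw [hseq]
    exact hlim
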